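/- All semigroups are finite. A $0$-minimal ideal of a semigroup $S$ is a two-sided ideal that is minimal among the two-sided ideals different from $\emptyset$ and $\{0\}$ (if $S$ has no zero, this is the minimal ideal). A semigroup $S$ is a group mapping (GM) semigroup if it has a unique $0$-minimal ideal $I(S)$, this ideal is regular and contains a non-trivial maximal subgroup, and $S$ acts faithfully on $I(S)$ both by left and by right multiplication. Let $S$ be a GM semigroup, let $e\in I(S)$ be a non-zero idempotent, $G$ the maximal subgroup of $S$ with identity $e$, $R$ the $\mathcal R$-class of $e$, and $B$ the set of $\mathcal L$-classes of non-zero elements of $I(S)$. Then $S$ acts on $R$ by partial functions through right multiplication ($x\cdot s=xs$ if $xs\in R$, undefined otherwise), and $G$ acts on $R$ by left multiplication; if $I(S)\cong\mathcal M^0(G,A,B,C)$ is a Rees matrix representation, $R$ is identified with $G\times B$. Also $S$ acts on $B$ by partial functions, $L_x\cdot s=L_{xs}$ if $xs\ne 0$ and undefined otherwise, where $L_x$ denotes the $\mathcal L$-class of $x$; the image of this representation is denoted $RLM(S)$. A fiber of a partial function $f$ is a non-empty set $f^{-1}(q)$. The degree of a set of partial functions on a finite set is the maximal cardinality of a fiber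 of one of its members, and its graph of fibers is the simple graph on that set whose edges are the fibers with exactly two elements. The GM semigroup $S$ has degree $2$ if its action on $R$ has degree $2$; its graph of fibers $\Gamma'$ is that of its action on $R$, and $\Gamma$ denotes the graph of fibers of $(B,RLM(S))$. The trivial $G$-cover of $\Gamma$ is the graph with vertex set $G\times B$ in which $(g,b)$ and $(g',b')$ are adjacent if and only if $g=g'$ and $bb'$ is an edge of $\Gamma$, with the projection to $B$ and the action $h(g,b)=(hg,b)$ of $G$. We say that $\Gamma'$ is the trivial $G$-cover of $\Gamma$ if there is a graph isomorphism from $\Gamma'$ to the trivial $G$-cover of $\Gamma$ which commutes with the actions of $G$ and with the projections to $B$ (the projection of $x\in R$ being its $\mathcal L$-class). **Theorem.** Let $S$ be a GM semigroup of degree $2$ and let $e$ be any non-zero idempotent of $I(S)$. With the notation above, the following are equivalent: (i) the graph of fibers $\Gamma'$ of $S$ is the trivial $G$-cover of the graph of fibers $\Gamma$ of $RLM(S)$; (ii) $I(S)$ is isomorphic to a Rees matrix semigroup whose structure matrix has all entries in $\{0,1\}$ (if $S$ has no zero, to a Rees matrix semigroup without zero whose structure matrix has all entries equal to $1$); (iii)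 the subsemigroup of $I(S)$ generated by its idempotents has only trivial subgroups. -/

import Mathlib

universe u v w

namespace GMSemigroup

/-! ### Partial transformations, degree, graph of fibers -/

/-- Partial functions `Q → Q`; `f q = none` means that `f` is undefined at `q`. -/
def PTrans (Q : Type u) : Type u := Q → Option Q

/-- Composition of partial functions, from left to right: `q (f * g) = (q f) g`. -/
instance (Q : Type u) : Semigroup (PTrans Q) where
  mul f g := fun q => (f q).bind g
  mul_assoc f g h := by
    funext q
    exact Option.bind_assoc (f q) g h

theorem PTrans.mul_apply {Q : Type u} (f g : PTrans Q) (q : Q) :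
    (f * g) q = (f q).bind g := rfl

/-- The preimage of the point `q` under the partial function `f`. The nonempty preimages of
points are the fibers of `f`. -/
def PTrans.fiber {Q : Type u} (f : PTrans Q) (q : Q) : Set Q := {p | f p = some q}

/-- The degree of the transformation semigroup `(Q, T)`: the maximal cardinality of a fiber of an
element of `T`. -/
noncomputable def degree {Q : Type u} (T : Subsemigroup (PTrans Q)) : ℕ∞ :=
  ⨆ f ∈ T, ⨆ q : Q, (PTrans.fiber f q).encard

/-- The graph of fibers of `(Q, T)`: the edges are the fibers with exactly two elements. -/
def fiberGraph {Q : Type u} (T : Subsemigroup (PTrans Q)) : SimpleGraph Q where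
  Adj p q := p ≠ q ∧ ∃ f ∈ T, ∃ r : Q, PTrans.fiber f r = {p, q}
  symm := ⟨by
    rintro p q ⟨hne, f, hf, r, hr⟩
    exact ⟨hne.symm, f, hf, r, by rw [hr, Set.pair_comm]⟩⟩
  loopless := ⟨fun _ h => h.1 rfl⟩

/-! ### Covers of graphs -/

/-- The trivial `G`-cover of the graph `Γ`: vertices `G × V`, and for each edge `vw` of `Γ` and each
`g` in `G` an edge from `(g, v)` to `(g, w)`. -/
def trivialCover (G : Type u) {V : Type v} (Γ : SimpleGraph V) : SimpleGraph (G × V) where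
  Adj x y := x.1 = y.1 ∧ Γ.Adj x.2 y.2
  symm := ⟨fun _ _ h => ⟨h.1.symm, h.2.symm⟩⟩
  loopless := ⟨fun _ h => Γ.loopless.irrefl _ h.2⟩

/-- The graph `Γ'` with its `G`-action and the projection `p` onto the vertices of `Γ` is
(isomorphic, as a `G`-cover of `Γ`, to) the trivial `G`-cover of `Γ`: there is a graph isomorphism
onto the trivial cover that commutes with the actions of `G` and with the projections to `V`. -/
def IsTrivialCover (G : Type u) [Group G] {V' : Type v} {V : Type w} [MulAction G V']
    (Γ' : SimpleGraph V') (Γ : SimpleGraph V) (p : V' → V) : Prop :=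
  ∃ φ : Γ' ≃g trivialCover G Γ,
    (∀ x, (φ x).2 = p x) ∧ ∀ (g : G) (x : V'), φ (g • x) = (g * (φ x).1, (φ x).2)

/-! ### Rees matrix semigroups -/

/-- The underlying set `(A × G × B) ∪ {0}` of the Rees matrix semigroup `M⁰(G, A, B, C)`
with structure matrix `C : B × A → G ∪ {0}`; here `none` is the zero. -/
def ReesZero {G A B : Type u} (_C : B → A → WithZero G) : Type u := Option (A × G × B)

/-- `(a, g, b) (a', g', b')` is `(a, g C(b, a') g', b')` if `C(b, a') ≠ 0`, and `0` otherwise. -/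
def ReesZero.mul {G A B : Type u} [Group G] (C : B → A → WithZero G) :
    Option (A × G × B) → Option (A × G × B) → Option (A × G × B)
  | some (a, g, b), some (a', g', b') =>
    WithZero.recZeroCoe (motive := fun _ => Option (A × G × B)) none
      (fun c => some (a, g * c * g', b')) (C b a')
  | _, _ => none

instance {G A B : Type u} [Group G] (C : B → A → WithZero G) : Semigroup (ReesZero C) where
  mul := ReesZero.mul C
  mul_assoc := by
    have h0 : ∀ y, ReesZero.mul C none y = none := fun _ => rfl
    have h1 : ∀ y, ReesZero.mul C y none = none := by
      rintro (_ | _) <;> rfl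
    rintro (_ | ⟨a, g, b⟩) (_ | ⟨a', g', b'⟩) (_ | ⟨a'', g'', b''⟩)
    all_goals change ReesZero.mul C (ReesZero.mul C _ _) _ = ReesZero.mul C _ (ReesZero.mul C _ _)
    all_goals try simp only [h0, h1]
    simp only [ReesZero.mul]
    cases hc : C b a' with
    | zero => cases hd : C b' a'' <;> simp [hc]
    | coe c => cases hd : C b' a'' <;> simp [hc, hd, mul_assoc]

/-- The Rees matrix semigroup without zero `M(G, A, B, C)`, with `C : B × A → G`. -/
def Rees {G A B : Type u} (_C : B → A → G) : Type u := A × G × B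

/-- `(a, g, b) (a', g', b') = (a, g C(b, a') g', b')`. -/
instance {G A B : Type u} [Group G] (C : B → A → G) : Semigroup (Rees C) where
  mul x y := (x.1, x.2.1 * C x.2.2 y.1 * y.2.1, y.2.2)
  mul_assoc x y z := by
    refine Prod.ext rfl (Prod.ext ?_ rfl)
    change x.2.1 * C x.2.2 y.1 * y.2.1 * C y.2.2 z.1 * z.2.1 =
      x.2.1 * C x.2.2 y.1 * (y.2.1 * C y.2.2 z.1 * z.2.1)
    simp only [mul_assoc]

/-- `T` is isomorphic to a Rees matrix semigroup all of whose structure matrix entries are `0` or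
`1`. The second case is that of a semigroup `T` that has no zero; then the Rees matrix semigroup
has no zero either, and all entries are `1`. -/
def HasZeroOneReesForm (T : Type u) [Mul T] : Prop :=
  (∃ (G A B : Type u) (_ : Group G) (C : B → A → WithZero G),
      (∀ b a, C b a = 0 ∨ C b a = 1) ∧ Nonempty (T ≃* ReesZero C)) ∨
    ∃ (G A B : Type u) (_ : Group G) (C : B → A → G),
      (∀ b a, C b a = 1) ∧ Nonempty (T ≃* Rees C)

/-! ### Basic notions for semigroups -/

section Basics

variable {S : Type u} [Semigroup S]

/-- `z` is the zero of the semigroup. -/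
def IsZeroElt (z : S) : Prop := ∀ s : S, z * s = z ∧ s * z = z

/-- `I` is a two-sided ideal. -/
abbrev IsTwoSided (I : Subsemigroup S) : Prop := ∀ x ∈ I, ∀ s : S, s * x ∈ I ∧ x * s ∈ I

/-- `I` is a 0-minimal ideal: a two-sided ideal other than `∅` and `{0}`, minimal with this
property. (An ideal with exactly one element is `{0}`, so ideals other than `∅`, `{0}` are those
with at least two elements.) If `S` has no zero, this is the minimal ideal of `S`. -/
def IsZeroMinimal (I : Subsemigroup S) : Prop :=
  Minimal (fun J : Subsemigroup S => IsTwoSided J ∧ (J : Set S).Nontrivial) I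

/-- `x` belongs to the right ideal `y S¹`. -/
def LeR (x y : S) : Prop := x = y ∨ ∃ u, x = y * u

/-- `x` belongs to the left ideal `S¹ y`. -/
def LeL (x y : S) : Prop := x = y ∨ ∃ u, x = u * y

/-- Green's relation `R`. -/
def GreenR (x y : S) : Prop := LeR x y ∧ LeR y x

/-- Green's relation `L`. -/
def GreenL (x y : S) : Prop := LeL x y ∧ LeL y x

theorem LeR.trans {x y z : S} (h : LeR x y) (h' : LeR y z) : LeR x z := by
  rcases h with rfl | ⟨u, rfl⟩
  · exact h'
  · rcases h' with rfl | ⟨v, rfl⟩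
    · exact Or.inr ⟨u, rfl⟩
    · exact Or.inr ⟨v * u, mul_assoc _ _ _⟩

theorem LeL.trans {x y z : S} (h : LeL x y) (h' : LeL y z) : LeL x z := by
  rcases h with rfl | ⟨u, rfl⟩
  · exact h'
  · rcases h' with rfl | ⟨v, rfl⟩
    · exact Or.inr ⟨u, rfl⟩
    · exact Or.inr ⟨u * v, (mul_assoc _ _ _).symm⟩

theorem LeL.mul_right {x y : S} (h : LeL x y) (s : S) : LeL (x * s) (y * s) := by
  rcases h with rfl | ⟨u, rfl⟩
  · exact Or.inl rfl
  · exact Or.inr ⟨u, mul_assoc _ _ _⟩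

theorem IsZeroElt.of_leL {x y : S} (h : LeL x y) (hy : IsZeroElt y) : IsZeroElt x := by
  rcases h with rfl | ⟨u, rfl⟩
  · exact hy
  · rw [(hy u).2]
    exact hy

/-! ### Maximal subgroups -/

/-- For an idempotent `e`, the local monoid `e S e`, with identity element `e`. -/
instance {e : S} (he : IsIdempotentElem e) : Monoid he.Corner where
  mul x y := ⟨x.1 * y.1, (Subsemigroup.corner e).mul_mem x.2 y.2⟩
  mul_assoc x y z := Subtype.ext (mul_assoc x.1 y.1 z.1)
  one := ⟨e, (Subsemigroup.mem_corner_iff he).2 ⟨he.eq, he.eq⟩⟩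
  one_mul x := Subtype.ext ((Subsemigroup.mem_corner_iff he).1 x.2).1
  mul_one x := Subtype.ext ((Subsemigroup.mem_corner_iff he).1 x.2).2

/-- The maximal subgroup of `S` with identity element `e`: the group of units of `e S e`. -/
abbrev MaxSubgroup {e : S} (he : IsIdempotentElem e) : Type u := (he.Corner)ˣ

/-- The element of `S` underlying an element of the maximal subgroup. -/
def MaxSubgroup.val {e : S} {he : IsIdempotentElem e} (g : MaxSubgroup he) : S :=
  (g : he.Corner).1

theorem MaxSubgroup.left_id {e : S} {he : IsIdempotentElem e} (g : MaxSubgroup he) :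
    e * g.val = g.val := ((Subsemigroup.mem_corner_iff he).1 (g : he.Corner).2).1

theorem MaxSubgroup.right_id {e : S} {he : IsIdempotentElem e} (g : MaxSubgroup he) :
    g.val * e = g.val := ((Subsemigroup.mem_corner_iff he).1 (g : he.Corner).2).2

theorem MaxSubgroup.val_mul_inv {e : S} {he : IsIdempotentElem e} (g : MaxSubgroup he) :
    g.val * (g⁻¹).val = e := congrArg Subtype.val (Units.mul_inv g)

/-- All subgroups of `T` are trivial. -/
def OnlyTrivialSubgroups (T : Subsemigroup S) : Prop :=
  ∀ (K : Type u) [Group K] (f : K →ₙ* T), Function.Injective f → Subsingleton K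

/-- The subsemigroup generated by the idempotents of `I`. -/
def idempotentGenerated (I : Subsemigroup S) : Subsemigroup S :=
  Subsemigroup.closure {f | f ∈ I ∧ IsIdempotentElem f}

/-! ### Group mapping semigroups -/

/-- `S` is a group mapping (GM) semigroup with distinguished ideal `I = I(S)`: `I` is the unique
0-minimal ideal of `S`, it is regular and has a nontrivial maximal subgroup, and `S` acts
faithfully on `I` by left multiplication and by right multiplication. -/
structure IsGroupMapping (I : Subsemigroup S) : Prop where
  zeroMinimal : IsZeroMinimal I
  unique : ∀ J : Subsemigroup S, IsZeroMinimal J → J = I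
  regular : ∀ x ∈ I, ∃ y ∈ I, x * y * x = x
  nontrivial_subgroup : ∃ (e : S) (he : IsIdempotentElem e), e ∈ I ∧ Nontrivial (MaxSubgroup he)
  faithful_left : ∀ s t : S, (∀ x ∈ I, s * x = t * x) → s = t
  faithful_right : ∀ s t : S, (∀ x ∈ I, x * s = x * t) → s = t

theorem IsGroupMapping.twoSided {I : Subsemigroup S} (h : IsGroupMapping I) : IsTwoSided I :=
  h.zeroMinimal.prop.1

/-! ### The action of `S` on an `R`-class, i.e. on `G × B` -/

/-- The `R`-class of `e`. -/
abbrev RClass (e : S) : Type u := {x : S // GreenR x e}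

open Classical in
/-- Right multiplication by `s` as a partial function on the `R`-class of `e`: `x · s = x s` if
`x s` is still in the `R`-class; otherwise `x · s` is undefined. -/
noncomputable def rightMul (e s : S) : PTrans (RClass e) :=
  fun x => if h : GreenR (x.1 * s) e then some ⟨x.1 * s, h⟩ else none

/-- The action of `S` by partial functions on the `R`-class of `e` by right multiplication. -/
noncomputable def rightAction (e : S) : S →ₙ* PTrans (RClass e) where
  toFun s := rightMul e s
  map_mul' s t := by
    funext x
    rw [PTrans.mul_apply]
    unfold rightMul
    by_cases h : GreenR (x.1 * s) e
    · by_cases k : GreenR (x.1 * (s * t)) e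
      · have k' : GreenR (x.1 * s * t) e := by rwa [mul_assoc]
        simp only [dif_pos h, Option.bind_some, dif_pos k, dif_pos k', mul_assoc]
      · have k' : ¬ GreenR (x.1 * s * t) e := by rwa [mul_assoc]
        simp only [dif_pos h, Option.bind_some, dif_neg k, dif_neg k']
    · have h' : ¬ GreenR (x.1 * (s * t)) e := by
        intro k
        refine h ⟨LeR.trans (Or.inr ⟨s, rfl⟩) x.2.1, ?_⟩
        exact k.2.trans (Or.inr ⟨t, (mul_assoc _ _ _).symm⟩)
      simp only [dif_neg h, dif_neg h', Option.bind_none]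

/-- The transformation semigroup `(G × B, S)` in coordinate-free form. If `e` is a nonzero
idempotent of `I(S) ≅ M⁰(G, A, B, C)`, the `R`-class of `e` is `{a} × G × B` for some `a` in `A`,
and `S` acts on it by right multiplication. -/
noncomputable def actionTS (e : S) : Subsemigroup (PTrans (RClass e)) := (rightAction e).srange

/-- The maximal subgroup `G` at `e` acts on the `R`-class of `e` by left multiplication; in
coordinates, `h (g, b) = (h g, b)`. -/
instance {e : S} (he : IsIdempotentElem e) : MulAction (MaxSubgroup he) (RClass e) where
  smul g x := ⟨g.val * x.1, Or.inr ⟨g.val * x.1, by rw [← mul_assoc, g.left_id]⟩, by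
    rcases x.2.2 with h | ⟨u, h⟩
    · exact Or.inr ⟨(g⁻¹).val, by rw [← h, g.right_id, g.val_mul_inv]⟩
    · refine Or.inr ⟨u * (g⁻¹).val, ?_⟩
      rw [← mul_assoc, mul_assoc g.val, ← h, g.right_id, g.val_mul_inv]⟩
  one_smul x := Subtype.ext (by
    change e * x.1 = x.1
    rcases x.2.1 with h | ⟨u, h⟩
    · rw [h, he.eq]
    · rw [h, ← mul_assoc, he.eq])
  mul_smul g h x := Subtype.ext (mul_assoc g.val h.val x.1)

/-! ### `RLM(S)`: the action of `S` on the `L`-classes of `I(S)` -/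

/-- Green's relation `L` on the nonzero elements of `I`. -/
def lSetoid (I : Subsemigroup S) : Setoid {x : S // x ∈ I ∧ ¬ IsZeroElt x} where
  r x y := GreenL x.1 y.1
  iseqv :=
    { refl := fun _ => ⟨Or.inl rfl, Or.inl rfl⟩
      symm := fun h => ⟨h.2, h.1⟩
      trans := fun h k => ⟨h.1.trans k.1, k.2.trans h.2⟩ }

/-- The set `B` of nonzero `L`-classes of `I`. -/
abbrev LClass (I : Subsemigroup S) : Type u := Quotient (lSetoid I)

/-- The `L`-class of a nonzero element of `I`. -/
def LClass.mk {I : Subsemigroup S} (x : S) (hx : x ∈ I) (h0 : ¬ IsZeroElt x) : LClass I :=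
  Quotient.mk (lSetoid I) ⟨x, hx, h0⟩

open Classical in
/-- Right multiplication by `s` as a partial function on the nonzero `L`-classes of the ideal `I`:
the `L`-class of `x` is sent to the `L`-class of `x s` if `x s` is nonzero; the function is
undefined there otherwise. -/
noncomputable def lMul {I : Subsemigroup S} (hI : IsTwoSided I) (s : S) : PTrans (LClass I) :=
  Quotient.lift
    (fun x : {x : S // x ∈ I ∧ ¬ IsZeroElt x} =>
      if h : IsZeroElt (x.1 * s) then (none : Option (LClass I))
      else some (LClass.mk (x.1 * s) (hI x.1 x.2.1 s).2 h))
    (by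
      intro x y hxy
      have h1 : GreenL (x.1 * s) (y.1 * s) := ⟨LeL.mul_right hxy.1 s, LeL.mul_right hxy.2 s⟩
      by_cases h : IsZeroElt (x.1 * s)
      · have h' : IsZeroElt (y.1 * s) := h.of_leL h1.2
        simp only [dif_pos h, dif_pos h']
      · have h' : ¬ IsZeroElt (y.1 * s) := fun k => h (k.of_leL h1.1)
        simp only [dif_neg h, dif_neg h']
        exact congrArg some (Quotient.sound h1))

open Classical in
theorem lMul_mk {I : Subsemigroup S} (hI : IsTwoSided I) (s x : S) (hx : x ∈ I)
    (h0 : ¬ IsZeroElt x) :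
    lMul hI s (LClass.mk x hx h0) =
      if h : IsZeroElt (x * s) then none else some (LClass.mk (x * s) (hI x hx s).2 h) := rfl

/-- The action of `S` by partial functions on the nonzero `L`-classes of the ideal `I` by right
multiplication. -/
noncomputable def lAction {I : Subsemigroup S} (hI : IsTwoSided I) : S →ₙ* PTrans (LClass I) where
  toFun s := lMul hI s
  map_mul' s t := by
    funext L
    rw [PTrans.mul_apply]
    induction L using Quotient.ind with
    | _ x =>
      obtain ⟨x, hx, h0⟩ := x
      change lMul hI (s * t) (LClass.mk x hx h0) =
        (lMul hI s (LClass.mk x hx h0)).bind (lMul hI t)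
      rw [lMul_mk, lMul_mk]
      by_cases h : IsZeroElt (x * s)
      · have h' : IsZeroElt (x * (s * t)) := by
          rw [← mul_assoc, (h t).1]
          exact h
        rw [dif_pos h, dif_pos h']
        rfl
      · rw [dif_neg h]
        change _ = lMul hI t (LClass.mk (x * s) (hI x hx s).2 h)
        rw [lMul_mk]
        by_cases k : IsZeroElt (x * (s * t))
        · have k' : IsZeroElt (x * s * t) := by rwa [mul_assoc]
          rw [dif_pos k, dif_pos k']
        · have k' : ¬ IsZeroElt (x * s * t) := by rwa [mul_assoc]
          simp only [dif_neg k, dif_neg k', mul_assoc]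

/-- The transformation semigroup `(B, RLM(S))`, where `S` is a GM semigroup with distinguished
ideal `I`: the image of the representation of `S` on the `L`-classes of `I`. -/
noncomputable def RLM {I : Subsemigroup S} (hI : IsTwoSided I) : Subsemigroup (PTrans (LClass I)) :=
  (lAction hI).srange

/-- The projection from the `R`-class of a nonzero element `e` of `I` to the set of `L`-classes of
`I`; in coordinates, the projection from `G × B` to `B`. -/
def toLClass {I : Subsemigroup S} (hI : IsTwoSided I) {e : S} (heI : e ∈ I)
    (he0 : ¬ IsZeroElt e) (x : RClass e) : LClass I :=
  LClass.mk x.1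
    (by
      rcases x.2.1 with h | ⟨u, h⟩
      · rw [h]
        exact heI
      · rw [h]
        exact (hI e heI u).2)
    (by
      intro hz
      apply he0
      rcases x.2.2 with h | ⟨u, h⟩
      · rw [h]
        exact hz
      · rw [h, (hz u).1]
        exact hz)

end Basics

end GMSemigroup

/-! Each of the three conditions amounts to the existence of a trivialization (`IsTrivialization`):
a `G`-equivariant map `f : R → G` with `f x = f x'` whenever `x y = e = x' y` for some `y`. Such an
`f` is constant on every fiber of the action on `R`, since a common value `x s = x' s` in `R` can be
carried to `e` by a further right multiplication.

From (i) to `f`: take the `G`-coordinate of the isomorphism onto the trivial cover. In degree 2,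
distinct points of one fiber are adjacent, so they share this coordinate.

From `f` to (ii): choose representatives of the rows with `f x = 1`, and of the columns so that they
have a left inverse `x₀` with `f x₀ = 1`. By `IsTrivialization.mul_eq` every nonzero entry of the
structure matrix is then the identity.

From (ii) to (iii): with entries in `{0, 1}`, nonzero products multiply `G`-coordinates. Nonzero
idempotents thus have coordinate 1, and so do their nonzero products.

From (iii) to `f`: link `x` and `x'` if they have a common right inverse `y`. Then `x' = x (y x')`
with `y x'` idempotent. If a chain of links joins `x` to `g x`, then `g x = x t` with `t` a product
of idempotents, which forces `g = 1`. So `G` acts freely on the classes of linked elements, and a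
free action has an equivariant map to `G`.

From `f` to (i): `x ↦ (f x, L_x)` is a bijection `R → G × B`, and each fiber on `R` maps bijectively
onto a fiber on `B` (`IsTrivialization.fiberGraph_adj_iff`). -/

namespace GMSemigroup

/-! ### Equivariant functions constant on the classes of an invariant equivalence relation -/

/-- `G` acts freely on the classes of `s`. Choose a point in each orbit of classes; `f x` is the
unique group element carrying the chosen point into the class of `x`. -/
theorem exists_equivariant_of_free {G X : Type*} [Group G] [MulAction G X] (s : Setoid X)
    (hinv : ∀ (g : G) (x y : X), s x y → s (g • x) (g • y))
    (hfree : ∀ (g : G) (x : X), s (g • x) x → g = 1) :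
    ∃ f : X → G, (∀ (g : G) (x : X), f (g • x) = g * f x) ∧ ∀ x y, s x y → f x = f y := by
  let o : Setoid X :=
    { r := fun x y => ∃ g : G, s (g • x) y
      iseqv :=
        { refl := fun x => ⟨1, by rw [one_smul]⟩
          symm := by
            rintro x y ⟨g, h⟩
            refine ⟨g⁻¹, ?_⟩
            have := hinv g⁻¹ _ _ h
            rw [inv_smul_smul] at this
            exact s.symm this
          trans := by
            rintro x y z ⟨g, h⟩ ⟨k, h'⟩
            refine ⟨k * g, ?_⟩
            rw [mul_smul]
            exact s.trans (hinv k _ _ h) h' } }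
  have hr : ∀ x, ∃ g : G, s (g • (Quotient.mk o x).out) x := fun x => Quotient.mk_out (s := o) x
  choose f hf using hr
  have huniq : ∀ (a b : G) (x : X), s (a • x) (b • x) → a = b := by
    intro a b x h
    have := hinv b⁻¹ _ _ h
    rw [inv_smul_smul, smul_smul] at this
    exact (inv_mul_eq_one.1 (hfree _ _ this)).symm
  refine ⟨f, fun g x => ?_, fun x y h => ?_⟩
  · have ho : Quotient.mk o (g • x) = Quotient.mk o x :=
      Quotient.sound (s := o) ⟨g⁻¹, by rw [inv_smul_smul]⟩
    have h1 := hf (g • x)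
    rw [ho] at h1
    refine huniq _ _ _ (s.trans h1 ?_)
    rw [mul_smul]
    exact s.symm (hinv g _ _ (hf x))
  · have ho : Quotient.mk o y = Quotient.mk o x :=
      Quotient.sound (s := o) ⟨1, by rw [one_smul]; exact s.symm h⟩
    have h1 := hf y
    rw [ho] at h1
    exact huniq _ _ _ (s.trans (hf x) (s.trans h (s.symm h1)))

/-! ### Zero elements and maximal subgroups -/

section Basics

variable {S : Type*} [Semigroup S]

theorem IsZeroElt.mul_right {x : S} (h : IsZeroElt x) (s : S) : IsZeroElt (x * s) := by
  rw [(h s).1]; exact h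

theorem IsZeroElt.mul_left {x : S} (h : IsZeroElt x) (s : S) : IsZeroElt (s * x) := by
  rw [(h s).2]; exact h

theorem IsZeroElt.eq {x y : S} (hx : IsZeroElt x) (hy : IsZeroElt y) : x = y := by
  rw [← (hx y).1, (hy x).2]

/-- In the finite monoid `e S e`, one-sided inverses are two-sided: left translation by `d` is
injective, hence surjective. -/
theorem corner_mul_eq_comm [Finite S] {e : S} (he : IsIdempotentElem e) {c d : S}
    (hc : e * c = c ∧ c * e = c) (hd : e * d = d ∧ d * e = d) (h : c * d = e) : d * c = e := by
  have : Finite he.Corner := inferInstanceAs (Finite (Subsemigroup.corner e))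
  let c' : he.Corner := ⟨c, (Subsemigroup.mem_corner_iff he).2 hc⟩
  let d' : he.Corner := ⟨d, (Subsemigroup.mem_corner_iff he).2 hd⟩
  have h1 : c' * d' = 1 := Subtype.ext h
  have h2 : d' * c' = 1 := by
    obtain ⟨a, ha⟩ := (Finite.surjective_of_injective (f := fun a : he.Corner => d' * a)
      (fun a b hab => by
        have hab' : c' * (d' * a) = c' * (d' * b) := congrArg (c' * ·) hab
        simpa only [← mul_assoc, h1, one_mul] using hab')) 1
    have ha' : d' * a = 1 := ha
    have hac : a = c' := by
      rw [← one_mul a, ← h1, mul_assoc, ha', mul_one]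
    rw [← hac, ha']
  exact congrArg Subtype.val h2

namespace MaxSubgroup

variable {e : S} {he : IsIdempotentElem e}

theorem exists_val_eq {c d : S} (hc : e * c = c ∧ c * e = c) (hd : e * d = d ∧ d * e = d)
    (h : c * d = e) (h' : d * c = e) : ∃ g : MaxSubgroup he, g.val = c :=
  ⟨⟨⟨c, (Subsemigroup.mem_corner_iff he).2 hc⟩, ⟨d, (Subsemigroup.mem_corner_iff he).2 hd⟩,
    Subtype.ext h, Subtype.ext h'⟩, rfl⟩

theorem val_one : (1 : MaxSubgroup he).val = e := rfl

theorem val_mul (g h : MaxSubgroup he) : (g * h).val = g.val * h.val := rfl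

theorem val_inv_mul (g : MaxSubgroup he) : (g⁻¹).val * g.val = e :=
  congrArg Subtype.val (Units.inv_mul g)

theorem val_injective : Function.Injective (MaxSubgroup.val : MaxSubgroup he → S) :=
  fun _ _ h => Units.ext (Subtype.ext h)

theorem not_isZeroElt (he0 : ¬ IsZeroElt e) (g : MaxSubgroup he) : ¬ IsZeroElt g.val :=
  fun h => he0 (by rw [← g.val_mul_inv]; exact h.mul_right _)

end MaxSubgroup

namespace RClass

variable {e : S}

theorem left_id (he : IsIdempotentElem e) (x : RClass e) : e * x.1 = x.1 := by
  rcases x.2.1 with h | ⟨u, h⟩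
  · rw [h, he.eq]
  · rw [h, ← mul_assoc, he.eq]

theorem mem {I : Subsemigroup S} (hI : IsTwoSided I) (heI : e ∈ I) (x : RClass e) : x.1 ∈ I := by
  rcases x.2.1 with h | ⟨u, h⟩
  · rw [h]; exact heI
  · rw [h]; exact (hI e heI u).2

theorem exists_mul_eq (he : IsIdempotentElem e) (x : RClass e) :
    ∃ y, x.1 * y = e ∧ y * e = y := by
  rcases x.2.2 with h | ⟨u, h⟩
  · exact ⟨e, by rw [← h, he.eq], he.eq⟩
  · exact ⟨u * e, by rw [← mul_assoc, ← h, he.eq], by rw [mul_assoc, he.eq]⟩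

theorem not_isZeroElt (he : IsIdempotentElem e) (he0 : ¬ IsZeroElt e) (x : RClass e) :
    ¬ IsZeroElt x.1 := by
  obtain ⟨y, h, -⟩ := x.exists_mul_eq he
  exact fun hz => he0 (by rw [← h]; exact hz.mul_right _)

theorem smul_val {he : IsIdempotentElem e} (g : MaxSubgroup he) (x : RClass e) :
    (g • x).1 = g.val * x.1 := rfl

end RClass

end Basics

/-! ### The 0-minimal ideal of a group mapping semigroup -/

namespace IsGroupMapping

section Structure

variable {S : Type*} [Semigroup S] {I : Subsemigroup S}

theorem mem_of_isZeroElt (hS : IsGroupMapping I) {z : S} (hz : IsZeroElt z) : z ∈ I := by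
  obtain ⟨x, hx, -⟩ := hS.zeroMinimal.prop.2
  rw [← (hz x).2]
  exact (hS.twoSided x hx z).2

/-- `S x S` is an ideal inside `I`, and regularity puts `x` in it, so 0-minimality makes it all of
`I`. -/
theorem exists_eq_mul_mul (hS : IsGroupMapping I) {x : S} (hx : x ∈ I) (h0 : ¬ IsZeroElt x)
    {w : S} (hw : w ∈ I) : ∃ a b, w = a * x * b := by
  have hI := hS.twoSided
  let J : Subsemigroup S :=
    { carrier := {w | ∃ a b, w = a * x * b}
      mul_mem' := by
        rintro _ _ ⟨a, b, rfl⟩ ⟨c, d, rfl⟩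
        exact ⟨a, b * (c * x * d), by simp only [mul_assoc]⟩ }
  have hJ : IsTwoSided J := by
    rintro _ ⟨a, b, rfl⟩ s
    exact ⟨⟨s * a, b, by simp only [mul_assoc]⟩, ⟨a, b * s, by simp only [mul_assoc]⟩⟩
  have hJI : J ≤ I := by
    rintro _ ⟨a, b, rfl⟩
    exact (hI _ (hI _ hx a).1 b).2
  have hxJ : x ∈ J := by
    obtain ⟨y, -, hy⟩ := hS.regular x hx
    exact ⟨x * y, y * x, by rw [hy, ← mul_assoc, hy]⟩
  have hnt : (J : Set S).Nontrivial := by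
    -- If `S x S` were the single point `x`, then `x` would be a zero.
    by_contra hs
    rw [Set.not_nontrivial_iff] at hs
    exact h0 fun s => ⟨hs (hJ x hxJ s).2 hxJ, hs (hJ x hxJ s).1 hxJ⟩
  exact hS.zeroMinimal.le_of_le ⟨hJ, hnt⟩ hJI hw

variable {e : S}

variable [Finite S]

/-- From `e = a x b` one gets `(e a e) (x b e) = e` in `e S e`. By finiteness the factors commute,
which places `x` on the left. -/
theorem exists_mul_eq (hS : IsGroupMapping I) (he : IsIdempotentElem e) (heI : e ∈ I) {x : S}
    (hx : x ∈ I) (h0 : ¬ IsZeroElt x) (hex : e * x = x) : ∃ y, x * y = e := by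
  obtain ⟨a, b, hab⟩ := hS.exists_eq_mul_mul hx h0 heI
  have h : e * a * e * (x * b * e) = e := by
    calc e * a * e * (x * b * e) = e * (a * (e * x) * b) * e := by simp only [mul_assoc]
      _ = e := by rw [hex, ← hab, he.eq, he.eq]
  have h' := corner_mul_eq_comm he ⟨by simp only [← mul_assoc, he.eq], by rw [mul_assoc, he.eq]⟩
    ⟨by simp only [← mul_assoc, hex], by rw [mul_assoc, he.eq]⟩ h
  exact ⟨b * e * (e * a * e), by simpa only [mul_assoc] using h'⟩

theorem exists_mul_eq' (hS : IsGroupMapping I) (he : IsIdempotentElem e) (heI : e ∈ I) {y : S}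
    (hy : y ∈ I) (h0 : ¬ IsZeroElt y) (hye : y * e = y) : ∃ x, x * y = e := by
  obtain ⟨a, b, hab⟩ := hS.exists_eq_mul_mul hy h0 heI
  have h : e * a * y * (e * b * e) = e := by
    calc e * a * y * (e * b * e) = e * (a * (y * e) * b) * e := by simp only [mul_assoc]
      _ = e := by rw [hye, ← hab, he.eq, he.eq]
  have h' := corner_mul_eq_comm he ⟨by simp only [← mul_assoc, he.eq], by rw [mul_assoc, hye]⟩
    ⟨by simp only [← mul_assoc, he.eq], by rw [mul_assoc, he.eq]⟩ h
  exact ⟨e * b * e * (e * a), by simpa only [mul_assoc] using h'⟩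

theorem greenR (hS : IsGroupMapping I) (he : IsIdempotentElem e) (heI : e ∈ I) {x : S}
    (hx : x ∈ I) (h0 : ¬ IsZeroElt x) (hex : e * x = x) : GreenR x e := by
  obtain ⟨y, hy⟩ := hS.exists_mul_eq he heI hx h0 hex
  exact ⟨Or.inr ⟨x, hex.symm⟩, Or.inr ⟨y, hy.symm⟩⟩

theorem greenR_mul (hS : IsGroupMapping I) (he : IsIdempotentElem e) (heI : e ∈ I)
    (x : RClass e) {s : S} (h0 : ¬ IsZeroElt (x.1 * s)) : GreenR (x.1 * s) e :=
  hS.greenR he heI (hS.twoSided _ (x.mem hS.twoSided heI) s).2 h0 (by rw [← mul_assoc, x.left_id he])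

/-- Every nonzero element of the ideal which has `e` as a right identity is a left divisor of an
element of the `R`-class of `e`. -/
theorem exists_rClass_mul_eq (hS : IsGroupMapping I) (he : IsIdempotentElem e) (heI : e ∈ I)
    (he0 : ¬ IsZeroElt e) {y : S} (hy : y ∈ I) (h0 : ¬ IsZeroElt y) (hye : y * e = y) :
    ∃ x : RClass e, x.1 * y = e := by
  obtain ⟨u, hu⟩ := hS.exists_mul_eq' he heI hy h0 hye
  have h : e * u * y = e := by rw [mul_assoc, hu, he.eq]
  refine ⟨⟨e * u, hS.greenR he heI (hS.twoSided e heI u).2 (fun hz => he0 ?_) ?_⟩, h⟩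
  · rw [← h]; exact hz.mul_right _
  · rw [← mul_assoc, he.eq]

theorem exists_val_eq (hS : IsGroupMapping I) (he : IsIdempotentElem e) (heI : e ∈ I) {c : S}
    (hc : c ∈ I) (h0 : ¬ IsZeroElt c) (hec : e * c = c ∧ c * e = c) :
    ∃ g : MaxSubgroup he, g.val = c := by
  obtain ⟨y, hy⟩ := hS.exists_mul_eq he heI hc h0 hec.1
  have h : c * (e * y * e) = e := by
    simp only [← mul_assoc]
    rw [hec.2, hy, he.eq]
  have hd : e * (e * y * e) = e * y * e ∧ e * y * e * e = e * y * e :=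
    ⟨by simp only [← mul_assoc, he.eq], by rw [mul_assoc, he.eq]⟩
  exact MaxSubgroup.exists_val_eq hec hd h (corner_mul_eq_comm he hec hd h)

/-- Every nonzero element of the ideal is the product of an element of the `L`-class of `e` and an
element of the `R`-class of `e`. -/
theorem exists_eq_mul (hS : IsGroupMapping I) (he : IsIdempotentElem e) (heI : e ∈ I)
    (he0 : ¬ IsZeroElt e) {w : S} (hw : w ∈ I) (h0 : ¬ IsZeroElt w) :
    ∃ (y : S) (x₀ x : RClass e), y * e = y ∧ x₀.1 * y = e ∧ w = y * x.1 := by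
  obtain ⟨a, b, hab⟩ := hS.exists_eq_mul_mul heI he0 hw
  have hae : ¬ IsZeroElt (a * e) := fun h => h0 (by rw [hab]; exact h.mul_right _)
  have heb : ¬ IsZeroElt (e * b) := fun h => h0 (by rw [hab, mul_assoc]; exact h.mul_left _)
  have hae' : a * e * e = a * e := by rw [mul_assoc, he.eq]
  obtain ⟨x₀, hx₀⟩ := hS.exists_rClass_mul_eq he heI he0 (hS.twoSided e heI a).1 hae hae'
  refine ⟨a * e, x₀, ⟨e * b, hS.greenR he heI (hS.twoSided e heI b).2 heb ?_⟩, hae', hx₀, ?_⟩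
  · rw [← mul_assoc, he.eq]
  · rw [hab, ← mul_assoc, hae']

/-- Two elements of the `R`-class of `e` with the same `L`-class differ by an element of the
maximal subgroup at `e`. -/
theorem exists_smul_eq (hS : IsGroupMapping I) (he : IsIdempotentElem e) (heI : e ∈ I)
    (he0 : ¬ IsZeroElt e) {x x' : RClass e} (h : LeL x'.1 x.1) : ∃ g : MaxSubgroup he, g • x = x' := by
  rcases h with h | ⟨u, h⟩
  · exact ⟨1, by rw [one_smul]; exact Subtype.ext h.symm⟩
  · obtain ⟨v, hv, hve⟩ := x.exists_mul_eq he
    -- The required group element is `x' v`, where `x v = e`.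
    have hx : x'.1 * v * x.1 = x'.1 := by
      rw [h, mul_assoc u, hv, mul_assoc, x.left_id he]
    have h0 : ¬ IsZeroElt (x'.1 * v) := fun hz =>
      x'.not_isZeroElt he he0 (by rw [← hx]; exact hz.mul_right _)
    obtain ⟨g, hg⟩ := hS.exists_val_eq he heI
      (hS.twoSided _ (x'.mem hS.twoSided heI) v).2 h0
      ⟨by rw [← mul_assoc, x'.left_id he], by rw [mul_assoc, hve]⟩
    exact ⟨g, Subtype.ext (by rw [RClass.smul_val, hg, hx])⟩

end Structure

end IsGroupMapping

/-! ### Trivializations of the `R`-class of an idempotent -/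

/-- A `G`-equivariant function from the `R`-class of `e` to the maximal subgroup `G` at `e` that is
constant on the set of left inverses (with respect to `e`) of each element. In coordinates, it is a
rescaling of the rows of the structure matrix which makes each column constant on its support. -/
structure IsTrivialization {S : Type*} [Semigroup S] {e : S} (he : IsIdempotentElem e)
    (f : RClass e → MaxSubgroup he) : Prop where
  map_smul : ∀ (g : MaxSubgroup he) (x : RClass e), f (g • x) = g * f x
  eq_of_mul_eq : ∀ (x x' : RClass e) (y : S), x.1 * y = e → x'.1 * y = e → f x = f x'

namespace IsTrivialization

section Structure

variable {S : Type*} [Semigroup S] {I : Subsemigroup S} {e : S} {he : IsIdempotentElem e}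
  {f : RClass e → MaxSubgroup he}

theorem eq_of_mul_eq_mul (hf : IsTrivialization he f) {x x' : RClass e} {s : S}
    (h : x.1 * s = x'.1 * s) (hR : GreenR (x.1 * s) e) : f x = f x' := by
  obtain ⟨y, hy, -⟩ := RClass.exists_mul_eq he ⟨x.1 * s, hR⟩
  refine hf.eq_of_mul_eq x x' (s * y) ?_ ?_
  · rw [← mul_assoc]; exact hy
  · rw [← mul_assoc, ← h]; exact hy

variable [Finite S]

/-- Put `x y = g` in `G`. Then `g⁻¹ x` and `x₀` are both left inverses of `y`, so `g⁻¹ f(x) = f(x₀)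
= 1`. -/
theorem mul_eq (hf : IsTrivialization he f) (hS : IsGroupMapping I) (heI : e ∈ I)
    {y : S} (hye : y * e = y) {x₀ : RClass e} (hx₀ : x₀.1 * y = e) (hfx₀ : f x₀ = 1)
    (x : RClass e) (h0 : ¬ IsZeroElt (x.1 * y)) : x.1 * y = (f x).val := by
  obtain ⟨g, hg⟩ := hS.exists_val_eq he heI
    (hS.twoSided _ (x.mem hS.twoSided heI) y).2 h0
    ⟨by rw [← mul_assoc, x.left_id he], by rw [mul_assoc, hye]⟩
  have h : f (g⁻¹ • x) = f x₀ := by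
    refine hf.eq_of_mul_eq _ _ y ?_ hx₀
    rw [RClass.smul_val, mul_assoc, ← hg, g.val_inv_mul]
  rw [hf.map_smul, hfx₀, inv_mul_eq_one] at h
  rw [← hg, h]

theorem eq_of_leL (hf : IsTrivialization he f) (hS : IsGroupMapping I) (heI : e ∈ I)
    (he0 : ¬ IsZeroElt e) {x x' : RClass e} (h : LeL x'.1 x.1) (hxx : f x = f x') : x = x' := by
  obtain ⟨g, rfl⟩ := hS.exists_smul_eq he heI he0 h
  rw [hf.map_smul, right_eq_mul] at hxx
  rw [hxx, one_smul]

end Structure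

/-! ### Trivializations and Rees matrix semigroups -/

section Rees

variable {S : Type*} [Semigroup S] {I : Subsemigroup S} {e : S} {he : IsIdempotentElem e}

/-- Representatives of the `R`-classes of the `L`-class of `e`, normalized by `f`. -/
abbrev RClassRep (f : RClass e → MaxSubgroup he) : Type _ :=
  {y : S // y * e = y ∧ ∃ x₀ : RClass e, x₀.1 * y = e ∧ f x₀ = 1}

/-- Representatives of the `L`-classes of the `R`-class of `e`, normalized by `f`. -/
abbrev LClassRep (f : RClass e → MaxSubgroup he) : Type _ := {x : RClass e // f x = 1}

/-- The element of `S` with Rees coordinates `(y, g, x)`. -/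
def ofCoord (f : RClass e → MaxSubgroup he) (p : RClassRep f × MaxSubgroup he × LClassRep f) : S :=
  p.1.1 * (p.2.1 • p.2.2.1).1

variable {f : RClass e → MaxSubgroup he}

theorem ofCoord_mem (hI : IsTwoSided I) (heI : e ∈ I)
    (p : RClassRep f × MaxSubgroup he × LClassRep f) : ofCoord f p ∈ I :=
  (hI _ ((p.2.1 • p.2.2.1).mem hI heI) _).1

theorem not_isZeroElt_ofCoord (he0 : ¬ IsZeroElt e)
    (p : RClassRep f × MaxSubgroup he × LClassRep f) : ¬ IsZeroElt (ofCoord f p) := by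
  obtain ⟨⟨y, hye, x₀, hx₀, hfx₀⟩, g, x⟩ := p
  intro hz
  refine (g • x.1).not_isZeroElt he he0 ?_
  have h : IsZeroElt (x₀.1 * (y * (g • x.1).1)) := hz.mul_left x₀.1
  rwa [← mul_assoc, hx₀, RClass.left_id he] at h

theorem ofCoord_mul (a a' : RClassRep f) (g g' : MaxSubgroup he) (b b' : LClassRep f) :
    ofCoord f (a, g, b) * ofCoord f (a', g', b') =
      a.1 * g.val * (b.1.1 * a'.1) * (g'.val * b'.1.1) := by
  simp only [ofCoord, RClass.smul_val, mul_assoc]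

variable [Finite S]

/-- Multiplying by `x₀` on the left recovers `g x`, `f` separates `g` from `x`, and cancelling `g x`
on the right recovers `y`. -/
theorem ofCoord_injective (hf : IsTrivialization he f) (hS : IsGroupMapping I) (heI : e ∈ I)
    (he0 : ¬ IsZeroElt e) : Function.Injective (ofCoord f) := by
  rintro ⟨⟨y, hye, x₀, hx₀, hfx₀⟩, g, ⟨x, hx⟩⟩ ⟨⟨y', hye', x₀', hx₀', hfx₀'⟩, g', ⟨x', hx'⟩⟩ h
  change y * (g • x).1 = y' * (g' • x').1 at h
  have h1 : (g • x).1 = x₀.1 * y' * (g' • x').1 := by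
    rw [mul_assoc, ← h, ← mul_assoc, hx₀, RClass.left_id he]
  have h2 : x₀.1 * y' = e := by
    rw [hf.mul_eq hS heI hye' hx₀' hfx₀', hfx₀, MaxSubgroup.val_one]
    intro hz
    exact (g • x).not_isZeroElt he he0 (by rw [h1]; exact hz.mul_right _)
  rw [h2, RClass.left_id he] at h1
  have h3 : g • x = g' • x' := Subtype.ext h1
  have h4 : g = g' := by
    have := congrArg f h3
    rwa [hf.map_smul, hf.map_smul, hx, hx', mul_one, mul_one] at this
  subst h4
  have h5 : x = x' := MulAction.injective g h3
  subst h5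
  obtain ⟨v, hv, -⟩ := (g • x).exists_mul_eq he
  have h6 : y = y' := by
    have := congrArg (· * v) h
    simpa only [mul_assoc, hv, hye, hye'] using this
  subst h6
  rfl

theorem exists_ofCoord_eq (hf : IsTrivialization he f) (hS : IsGroupMapping I) (heI : e ∈ I)
    (he0 : ¬ IsZeroElt e) {w : S} (hw : w ∈ I) (h0 : ¬ IsZeroElt w) : ∃ p, ofCoord f p = w := by
  obtain ⟨y, x₀, x, hye, hx₀, rfl⟩ := hS.exists_eq_mul he heI he0 hw h0
  -- Normalize the factors of `w = y x`, writing `w = (y f(x₀)) (f(x₀)⁻¹ f(x)) (f(x)⁻¹ x)`.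
  refine ⟨⟨⟨y * (f x₀).val, by rw [mul_assoc, MaxSubgroup.right_id], (f x₀)⁻¹ • x₀, ?_, ?_⟩,
    (f x₀)⁻¹ * f x, ⟨(f x)⁻¹ • x, ?_⟩⟩, ?_⟩
  · rw [RClass.smul_val, mul_assoc, ← mul_assoc x₀.1, hx₀, MaxSubgroup.left_id,
      MaxSubgroup.val_inv_mul]
  · rw [hf.map_smul, inv_mul_cancel]
  · rw [hf.map_smul, inv_mul_cancel]
  · change y * (f x₀).val * (((f x₀)⁻¹ * f x) • ((f x)⁻¹ • x)).1 = _
    rw [smul_smul, mul_inv_cancel_right, RClass.smul_val, mul_assoc, ← mul_assoc (f x₀).val,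
      MaxSubgroup.val_mul_inv, x.left_id he]

theorem ofCoord_mul_of_not_isZeroElt (hf : IsTrivialization he f) (hS : IsGroupMapping I)
    (heI : e ∈ I) {a a' : RClassRep f} {b b' : LClassRep f} (h0 : ¬ IsZeroElt (b.1.1 * a'.1))
    (g g' : MaxSubgroup he) :
    ofCoord f (a, g, b) * ofCoord f (a', g', b') = ofCoord f (a, g * g', b') := by
  obtain ⟨x₀, hx₀, hfx₀⟩ := a'.2.2
  rw [ofCoord_mul, hf.mul_eq hS heI a'.2.1 hx₀ hfx₀ b.1 h0, b.2, MaxSubgroup.val_one, mul_assoc a.1,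
    MaxSubgroup.right_id]
  simp only [ofCoord, RClass.smul_val, MaxSubgroup.val_mul, mul_assoc]

open Classical in
theorem hasZeroOneReesForm (hf : IsTrivialization he f) (hS : IsGroupMapping I) (heI : e ∈ I)
    (he0 : ¬ IsZeroElt e) : HasZeroOneReesForm I := by
  by_cases hz : ∃ z : S, IsZeroElt z
  · obtain ⟨z, hz⟩ := hz
    left
    let C : LClassRep f → RClassRep f → WithZero (MaxSubgroup he) := fun b a =>
      if IsZeroElt (b.1.1 * a.1) then 0 else 1
    let F : ReesZero C → I := fun p =>
      p.elim ⟨z, hS.mem_of_isZeroElt hz⟩ fun p => ⟨ofCoord f p, ofCoord_mem hS.twoSided heI p⟩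
    refine ⟨_, _, _, inferInstance, C, fun b a => ?_, ⟨(MulEquiv.ofBijective
      (⟨F, ?_⟩ : ReesZero C →ₙ* I) ⟨?_, ?_⟩).symm⟩⟩
    · by_cases h : IsZeroElt (b.1.1 * a.1)
      · exact Or.inl (if_pos h)
      · exact Or.inr (if_neg h)
    · rintro (_ | ⟨a, g, b⟩) (_ | ⟨a', g', b'⟩)
      · exact Subtype.ext (hz z).1.symm
      · exact Subtype.ext (hz _).1.symm
      · exact Subtype.ext (hz _).2.symm
      · apply Subtype.ext
        change (F (ReesZero.mul C (some (a, g, b)) (some (a', g', b')))).1 =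
          ofCoord f (a, g, b) * ofCoord f (a', g', b')
        by_cases h : IsZeroElt (b.1.1 * a'.1)
        · have hC : C b a' = 0 := if_pos h
          simp only [ReesZero.mul, hC]
          rw [ofCoord_mul]
          exact hz.eq ((h.mul_left _).mul_right _)
        · have hC : C b a' = (1 : MaxSubgroup he) := if_neg h
          simp only [ReesZero.mul, hC]
          rw [hf.ofCoord_mul_of_not_isZeroElt hS heI h]
          change ofCoord f (a, g * 1 * g', b') = _
          rw [mul_one]
    · rintro (_ | p) (_ | q) h
      · rfl
      · exact absurd hz (by
          rw [show z = ofCoord f q from congrArg Subtype.val h]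
          exact not_isZeroElt_ofCoord he0 q)
      · exact absurd hz (by
          rw [show z = ofCoord f p from (congrArg Subtype.val h).symm]
          exact not_isZeroElt_ofCoord he0 p)
      · exact congrArg some (hf.ofCoord_injective hS heI he0 (congrArg Subtype.val h))
    · rintro ⟨w, hw⟩
      by_cases h0 : IsZeroElt w
      · exact ⟨none, Subtype.ext (hz.eq h0)⟩
      · obtain ⟨p, hp⟩ := hf.exists_ofCoord_eq hS heI he0 hw h0
        exact ⟨some p, Subtype.ext hp⟩
  · right
    have hz' : ∀ z : S, ¬ IsZeroElt z := fun z h => hz ⟨z, h⟩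
    let C : LClassRep f → RClassRep f → MaxSubgroup he := fun _ _ => 1
    let F : Rees C → I := fun p => ⟨ofCoord f p, ofCoord_mem hS.twoSided heI p⟩
    refine ⟨_, _, _, inferInstance, C, fun _ _ => rfl, ⟨(MulEquiv.ofBijective
      (⟨F, ?_⟩ : Rees C →ₙ* I) ⟨?_, ?_⟩).symm⟩⟩
    · rintro ⟨a, g, b⟩ ⟨a', g', b'⟩
      apply Subtype.ext
      change ofCoord f (a, g * 1 * g', b') = ofCoord f (a, g, b) * ofCoord f (a', g', b')
      rw [hf.ofCoord_mul_of_not_isZeroElt hS heI (hz' _), mul_one]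
    · exact fun p q h => hf.ofCoord_injective hS heI he0 (congrArg Subtype.val h)
    · rintro ⟨w, hw⟩
      obtain ⟨p, hp⟩ := hf.exists_ofCoord_eq hS heI he0 hw (hz' w)
      exact ⟨p, Subtype.ext hp⟩

end Rees

end IsTrivialization

/-! ### Subgroups of the idempotent-generated part -/

section IdempotentGenerated

theorem HasZeroOneReesForm.onlyTrivialSubgroups {S : Type*} [Semigroup S] {I : Subsemigroup S}
    (h : HasZeroOneReesForm I) : OnlyTrivialSubgroups (idempotentGenerated I) := by
  have hle : idempotentGenerated I ≤ I := Subsemigroup.closure_le.2 fun x hx => hx.1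
  rcases h with ⟨G, A, B, _, C, hC, ⟨φ⟩⟩ | ⟨G, A, B, _, C, hC, ⟨φ⟩⟩
  · let z : ReesZero C := none
    let m : A → G → B → ReesZero C := fun a g b => some (a, g, b)
    have hcases : ∀ x : ReesZero C, x = z ∨ ∃ a g b, x = m a g b := by
      rintro (_ | ⟨a, g, b⟩)
      · exact Or.inl rfl
      · exact Or.inr ⟨a, g, b, rfl⟩
    have hz : ∀ x, z * x = z := fun _ => rfl
    have hz' : ∀ x, x * z = z := by rintro (_ | _) <;> rfl
    have key : ∀ a g b a' g' b', m a g b * m a' g' b' = z ∨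
        m a g b * m a' g' b' = m a (g * g') b' := by
      intro a g b a' g' b'
      change ReesZero.mul C (some (a, g, b)) (some (a', g', b')) = none ∨
        ReesZero.mul C (some (a, g, b)) (some (a', g', b')) = some (a, g * g', b')
      rcases hC b a' with h | h
      · left
        simp only [ReesZero.mul, h]
        rfl
      · right
        have h' : C b a' = ((1 : G) : WithZero G) := h
        simp only [ReesZero.mul, h']
        change some (a, g * 1 * g', b') = _
        rw [mul_one]
    have hT : ∀ t (ht : t ∈ idempotentGenerated I), φ ⟨t, hle ht⟩ = z ∨
        ∃ a b, φ ⟨t, hle ht⟩ = m a 1 b := by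
      intro t ht
      induction ht using Subsemigroup.closure_induction with
      | mem t ht =>
        have hid : φ ⟨t, ht.1⟩ * φ ⟨t, ht.1⟩ = φ ⟨t, ht.1⟩ := by
          rw [← map_mul]; exact congrArg φ (Subtype.ext ht.2)
        rcases hcases (φ ⟨t, ht.1⟩) with h | ⟨a, g, b, h⟩
        · exact Or.inl h
        · rw [h] at hid
          rcases key a g b a g b with k | k
          · exact Or.inl (by rw [h, ← hid, k])
          · have h1 : (some (a, g * g, b) : Option (A × G × B)) = some (a, g, b) :=
              k.symm.trans hid
            simp only [Option.some.injEq, Prod.mk.injEq, mul_eq_left, true_and, and_true] at h1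
            exact Or.inr ⟨a, b, by rw [h, h1]⟩
      | mul s t hs ht ihs iht =>
        have hst : φ ⟨s * t, hle (mul_mem hs ht)⟩ = φ ⟨s, hle hs⟩ * φ ⟨t, hle ht⟩ := by
          rw [← map_mul]; rfl
        rw [hst]
        rcases ihs with h | ⟨a, b, h⟩
        · exact Or.inl (by rw [h, hz])
        · rcases iht with h' | ⟨a', b', h'⟩
          · exact Or.inl (by rw [h', hz'])
          · rw [h, h']
            rcases key a 1 b a' 1 b' with k | k
            · exact Or.inl k
            · exact Or.inr ⟨a, b', by rw [k, mul_one]⟩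
    intro K _ f hf
    let ψ : K → ReesZero C := fun k => φ ⟨f k, hle (f k).2⟩
    have hψ : ∀ k l, ψ (k * l) = ψ k * ψ l := fun k l => by
      change φ _ = φ _ * φ _
      rw [← map_mul]
      exact congrArg φ (Subtype.ext (by rw [map_mul]; rfl))
    have hψi : Function.Injective ψ := fun k l h =>
      hf (Subtype.ext (Subtype.mk.inj (φ.injective h)))
    -- A group whose embedded image contains the zero is trivial, since `k l` and `k` then have the
    -- same image.
    have hzero : ∀ k, ψ k = z → ∀ l : K, l = 1 := by
      intro k hk l
      have h1 : ψ (k * l) = ψ k := by rw [hψ, hk, hz]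
      exact mul_eq_left.1 (hψi h1)
    refine subsingleton_of_forall_eq 1 fun k => ?_
    rcases hT _ (f k).2 with h | ⟨a, b, h⟩
    · exact hzero k h k
    · have hk : ψ k = m a 1 b := h
      rcases key a 1 b a 1 b with h' | h'
      · exact hzero (k * k) (by rw [hψ, hk, h']) k
      · exact mul_eq_left.1 (hψi (by rw [hψ, hk, h', mul_one]))
  · have hmul : ∀ x y : Rees C, x * y = (x.1, x.2.1 * y.2.1, y.2.2) := fun x y => by
      change (x.1, x.2.1 * C x.2.2 y.1 * y.2.1, y.2.2) = _
      rw [hC, mul_one]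
    have hT : ∀ t (ht : t ∈ idempotentGenerated I), (φ ⟨t, hle ht⟩).2.1 = 1 := by
      intro t ht
      induction ht using Subsemigroup.closure_induction with
      | mem t ht =>
        have hid : φ ⟨t, ht.1⟩ * φ ⟨t, ht.1⟩ = φ ⟨t, ht.1⟩ := by
          rw [← map_mul]; exact congrArg φ (Subtype.ext ht.2)
        rw [hmul] at hid
        exact mul_eq_left.1 (congrArg (fun p : A × G × B => p.2.1) hid)
      | mul s t hs ht ihs iht =>
        have hst : φ ⟨s * t, hle (mul_mem hs ht)⟩ = φ ⟨s, hle hs⟩ * φ ⟨t, hle ht⟩ := by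
          rw [← map_mul]; rfl
        rw [hst, hmul]
        change _ * _ = _
        rw [ihs, iht, mul_one]
    intro K _ f hf
    refine subsingleton_of_forall_eq 1 fun k => ?_
    -- Elements with `G`-coordinate 1 are idempotent, and a group has only one idempotent.
    have h1 : φ ⟨f k, hle (f k).2⟩ * φ ⟨f k, hle (f k).2⟩ = φ ⟨f k, hle (f k).2⟩ := by
      rw [hmul]
      refine Prod.ext rfl (Prod.ext ?_ rfl)
      change _ * _ = _
      rw [hT _ (f k).2, mul_one]
    rw [← map_mul] at h1
    have h2 : f (k * k) = f k := by
      rw [map_mul]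
      exact Subtype.ext (Subtype.mk.inj (φ.injective h1))
    exact mul_eq_left.1 (hf h2)

variable {S : Type*} [Semigroup S] {I : Subsemigroup S} {e : S}

/-- Two elements of the `R`-class of `e` with a common right inverse (with respect to `e`) differ by
an idempotent of the ideal. -/
theorem exists_idempotentGenerated_mul_eq (hI : IsTwoSided I) (he : IsIdempotentElem e)
    (heI : e ∈ I) {x x' : RClass e} {y : S} (h : x.1 * y = e) (h' : x'.1 * y = e) :
    ∃ t ∈ idempotentGenerated I, x'.1 = x.1 * t := by
  refine ⟨y * x'.1, Subsemigroup.subset_closure ⟨(hI _ (x'.mem hI heI) y).1, ?_⟩, ?_⟩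
  · change y * x'.1 * (y * x'.1) = y * x'.1
    rw [mul_assoc, ← mul_assoc x'.1, h', x'.left_id he]
  · rw [← mul_assoc, h, x'.left_id he]

variable [Finite S]

/-- If `x t = g x` with `t` in the idempotent-generated part, then `g` belongs to a subgroup that
embeds into the idempotent-generated part. -/
theorem OnlyTrivialSubgroups.eq_one_of_smul_eq (h : OnlyTrivialSubgroups (idempotentGenerated I))
    (hI : IsTwoSided I) (he : IsIdempotentElem e) (heI : e ∈ I) {g : MaxSubgroup he}
    {x : RClass e} {t : S} (ht : t ∈ idempotentGenerated I) (hgx : (g • x).1 = x.1 * t) :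
    g = 1 := by
  obtain ⟨y, hy, hye⟩ := x.exists_mul_eq he
  have hmul : ∀ k l : MaxSubgroup he, y * (k.val * x.1) * (y * (l.val * x.1)) =
      y * ((k * l).val * x.1) := by
    intro k l
    calc y * (k.val * x.1) * (y * (l.val * x.1))
        = y * (k.val * (x.1 * y) * (l.val * x.1)) := by simp only [mul_assoc]
      _ = y * ((k * l).val * x.1) := by rw [hy, k.right_id, MaxSubgroup.val_mul, mul_assoc]
  have hyx : y * x.1 ∈ idempotentGenerated I := by
    refine Subsemigroup.subset_closure ⟨(hI _ (x.mem hI heI) y).1, ?_⟩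
    change y * x.1 * (y * x.1) = y * x.1
    rw [mul_assoc, ← mul_assoc x.1, hy, x.left_id he]
  -- The map `k ↦ y k x` embeds `G` in `I` as a subgroup with identity `y x`; `M` is the preimage of
  -- the idempotent-generated part.
  let M : Submonoid (MaxSubgroup he) :=
    { carrier := {k | y * (k.val * x.1) ∈ idempotentGenerated I}
      mul_mem' := fun {k l} hk hl => by
        change y * ((k * l).val * x.1) ∈ idempotentGenerated I
        rw [← hmul]
        exact mul_mem hk hl
      one_mem' := by
        change y * (e * x.1) ∈ idempotentGenerated I
        rw [x.left_id he]
        exact hyx }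
  have hgM : g ∈ M := by
    change y * (g • x).1 ∈ idempotentGenerated I
    rw [hgx, ← mul_assoc]
    exact mul_mem hyx ht
  have : Finite (MaxSubgroup he) := Finite.of_injective _ MaxSubgroup.val_injective
  -- As `G` is finite, the powers of `g` already form a group.
  have hK : ∀ k ∈ Subgroup.zpowers g, k ∈ M := fun k hk =>
    (Submonoid.powers_le.2 hgM) (mem_powers_iff_mem_zpowers.2 hk)
  let F : Subgroup.zpowers g →ₙ* idempotentGenerated I :=
    { toFun := fun k => ⟨y * (k.1.val * x.1), hK k.1 k.2⟩
      map_mul' := fun k l => Subtype.ext (hmul k.1 l.1).symm }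
  have hF : Function.Injective F := by
    intro k l hkl
    have h1 : y * (k.1.val * x.1) = y * (l.1.val * x.1) := congrArg Subtype.val hkl
    have h2 : ∀ k : MaxSubgroup he, x.1 * (y * (k.val * x.1)) * y = k.val := fun k => by
      rw [← mul_assoc, hy, mul_assoc, mul_assoc, hy, k.right_id, k.left_id]
    refine Subtype.ext (MaxSubgroup.val_injective ?_)
    rw [← h2 k.1, h1, h2]
  have := h _ F hF
  exact congrArg Subtype.val
    (Subsingleton.elim (⟨g, Subgroup.mem_zpowers g⟩ : Subgroup.zpowers g) 1)

theorem OnlyTrivialSubgroups.exists_isTrivialization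
    (h : OnlyTrivialSubgroups (idempotentGenerated I)) (hI : IsTwoSided I)
    (he : IsIdempotentElem e) (heI : e ∈ I) : ∃ f, IsTrivialization he f := by
  let r : RClass e → RClass e → Prop := fun x x' => ∃ y, x.1 * y = e ∧ x'.1 * y = e
  -- Both directions are carried so that the induction passes through symmetry.
  have hstep : ∀ x x', Relation.EqvGen r x x' →
      (∃ t ∈ idempotentGenerated I, x'.1 = x.1 * t) ∧
      ∃ t ∈ idempotentGenerated I, x.1 = x'.1 * t := by
    intro x x' hxx
    induction hxx with
    | rel x x' hxx =>
      obtain ⟨y, hy, hy'⟩ := hxx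
      exact ⟨exists_idempotentGenerated_mul_eq hI he heI hy hy',
        exists_idempotentGenerated_mul_eq hI he heI hy' hy⟩
    | refl x =>
      obtain ⟨y, hy, -⟩ := x.exists_mul_eq he
      have := exists_idempotentGenerated_mul_eq hI he heI hy hy
      exact ⟨this, this⟩
    | symm x x' _ ih => exact ih.symm
    | trans x x' x'' _ _ ih ih' =>
      obtain ⟨⟨t, ht, h1⟩, ⟨t', ht', h2⟩⟩ := ih
      obtain ⟨⟨s, hs, h3⟩, ⟨s', hs', h4⟩⟩ := ih'
      exact ⟨⟨t * s, mul_mem ht hs, by rw [h3, h1, mul_assoc]⟩,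
        ⟨s' * t', mul_mem hs' ht', by rw [h2, h4, mul_assoc]⟩⟩
  obtain ⟨f, hf, hf'⟩ := exists_equivariant_of_free (G := MaxSubgroup he) (Relation.EqvGen.setoid r)
    (by
      intro g x x' hxx
      induction hxx with
      | rel x x' hxx =>
        obtain ⟨y, hy, hy'⟩ := hxx
        -- Translating by `g` turns a common right inverse `y` into `y g⁻¹`.
        have hg : ∀ x : RClass e, x.1 * y = e → (g • x).1 * (y * (g⁻¹).val) = e := fun x hy => by
          rw [RClass.smul_val, mul_assoc, ← mul_assoc x.1, hy, MaxSubgroup.left_id, g.val_mul_inv]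
        exact Relation.EqvGen.rel _ _ ⟨y * (g⁻¹).val, hg x hy, hg x' hy'⟩
      | refl x => exact Relation.EqvGen.refl _
      | symm x x' _ ih => exact ih.symm
      | trans x x' x'' _ _ ih ih' => exact ih.trans _ _ _ ih')
    (by
      intro g x hgx
      obtain ⟨-, t, ht, h1⟩ := hstep _ _ hgx
      exact h.eq_one_of_smul_eq hI he heI ht h1)
  exact ⟨f, hf, fun x x' y hy hy' => hf' _ _ (Relation.EqvGen.rel _ _ ⟨y, hy, hy'⟩)⟩

end IdempotentGenerated

/-! ### Trivializations and the graphs of fibers -/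

section Cover

variable {S : Type*} [Semigroup S] {I : Subsemigroup S} {e : S} {he : IsIdempotentElem e}

theorem rightAction_apply (s : S) {x : RClass e} (h : GreenR (x.1 * s) e) :
    rightAction e s x = some ⟨x.1 * s, h⟩ := dif_pos h

theorem mem_fiber_rightAction {s : S} {x r : RClass e} :
    x ∈ PTrans.fiber (rightAction e s) r ↔ x.1 * s = r.1 := by
  constructor
  · intro h
    by_cases hR : GreenR (x.1 * s) e
    · have h' : rightAction e s x = some r := h
      rw [rightAction_apply s hR] at h'
      exact congrArg Subtype.val (Option.some.inj h')
    · have h' : rightAction e s x = some r := h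
      have : rightAction e s x = none := dif_neg hR
      rw [this] at h'
      cases h'
  · intro h
    have hR : GreenR (x.1 * s) e := by rw [h]; exact r.2
    change rightAction e s x = some r
    rw [rightAction_apply s hR]
    exact congrArg some (Subtype.ext h)

/-- A fiber with at most two points that contains `x ≠ x'` equals `{x, x'}`. This is where the
degree hypothesis enters. -/
theorem fiberGraph_adj_of_degree_le_two (hdeg : degree (actionTS e) ≤ 2) {x x' : RClass e}
    (hne : x ≠ x') {s : S} {r : RClass e} (h : x.1 * s = r.1) (h' : x'.1 * s = r.1) :
    (fiberGraph (actionTS e)).Adj x x' := by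
  have hmem : rightAction e s ∈ actionTS e := ⟨s, rfl⟩
  refine ⟨hne, _, hmem, r, ?_⟩
  have hcard : (PTrans.fiber (rightAction e s) r).encard ≤ 2 :=
    le_trans (le_iSup_of_le (rightAction e s) (le_iSup_of_le hmem
      (le_iSup (fun q => (PTrans.fiber (rightAction e s) q).encard) r))) hdeg
  have hsub : {x, x'} ⊆ PTrans.fiber (rightAction e s) r := by
    rintro z (rfl | rfl)
    · exact mem_fiber_rightAction.2 h
    · exact mem_fiber_rightAction.2 h'
  exact ((Set.toFinite _).eq_of_subset_of_encard_le hsub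
    (by rwa [Set.encard_pair hne])).symm

/-- If `x y = e = x' y`, then `x` and `x'` lie in the fiber of `y` over `e`; adjacent vertices of
the trivial cover have equal `G`-coordinates. -/
theorem IsTrivialCover.exists_isTrivialization (hI : IsTwoSided I) (heI : e ∈ I)
    (he0 : ¬ IsZeroElt e) (hdeg : degree (actionTS e) ≤ 2)
    (h : IsTrivialCover (MaxSubgroup he) (fiberGraph (actionTS e)) (fiberGraph (RLM hI))
      (toLClass hI heI he0)) : ∃ f, IsTrivialization he f := by
  obtain ⟨φ, -, hφ⟩ := h
  refine ⟨fun x => (φ x).1, fun g x => by rw [hφ], fun x x' y hy hy' => ?_⟩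
  by_cases hne : x = x'
  · rw [hne]
  · exact (φ.map_rel_iff.2 (fiberGraph_adj_of_degree_le_two hdeg hne
      (r := ⟨e, Or.inl rfl, Or.inl rfl⟩) hy hy')).1

variable {hI : IsTwoSided I} {heI : e ∈ I} {he0 : ¬ IsZeroElt e}

theorem toLClass_eq_iff {x x' : RClass e} :
    toLClass hI heI he0 x = toLClass hI heI he0 x' ↔ GreenL x.1 x'.1 :=
  ⟨fun h => Quotient.exact (s := lSetoid I) h, fun h => Quotient.sound (s := lSetoid I) h⟩

open Classical in
theorem lAction_toLClass (s : S) (x : RClass e) :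
    lAction hI s (toLClass hI heI he0 x) = if h : IsZeroElt (x.1 * s) then none
      else some (LClass.mk (x.1 * s) (hI x.1 (x.mem hI heI) s).2 h) := rfl

theorem lAction_toLClass_of_mem_RClass (he : IsIdempotentElem e) {s : S} {x : RClass e}
    (h : GreenR (x.1 * s) e) :
    lAction hI s (toLClass hI heI he0 x) = some (toLClass hI heI he0 ⟨x.1 * s, h⟩) := by
  rw [lAction_toLClass, dif_neg (RClass.not_isZeroElt he he0 ⟨x.1 * s, h⟩)]
  rfl

theorem toLClass_smul (g : MaxSubgroup he) (x : RClass e) :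
    toLClass hI heI he0 (g • x) = toLClass hI heI he0 x := by
  refine toLClass_eq_iff.2 ⟨Or.inr ⟨g.val, rfl⟩, Or.inr ⟨(g⁻¹).val, ?_⟩⟩
  rw [RClass.smul_val, ← mul_assoc, g.val_inv_mul, x.left_id he]

variable [Finite S]

/-- The action on `B` is the quotient of the action on `R` by `G`: left and right multiplications
commute, and the `L`-classes in `R` are the `G`-orbits. -/
theorem mem_fiber_lAction (hS : IsGroupMapping I) (he : IsIdempotentElem e) {s : S}
    {x r : RClass e} :
    toLClass hS.twoSided heI he0 x ∈
        PTrans.fiber (lAction hS.twoSided s) (toLClass hS.twoSided heI he0 r) ↔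
      ∃ g : MaxSubgroup he, (g • x).1 * s = r.1 := by
  constructor
  · intro h
    have h' : lAction hS.twoSided s (toLClass hS.twoSided heI he0 x) =
      some (toLClass hS.twoSided heI he0 r) := h
    by_cases h0 : IsZeroElt (x.1 * s)
    · rw [lAction_toLClass, dif_pos h0] at h'
      cases h'
    · rw [lAction_toLClass_of_mem_RClass he (hS.greenR_mul he heI x h0)] at h'
      obtain ⟨g, hg⟩ := hS.exists_smul_eq he heI he0 (toLClass_eq_iff.1 (Option.some.inj h')).2
      refine ⟨g, ?_⟩
      rw [← hg, RClass.smul_val, RClass.smul_val, mul_assoc]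
  · rintro ⟨g, hg⟩
    have hx : (g⁻¹ • r).1 = x.1 * s := by
      rw [RClass.smul_val, ← hg, RClass.smul_val, ← mul_assoc, ← mul_assoc, g.val_inv_mul,
        x.left_id he]
    have hR : GreenR (x.1 * s) e := by rw [← hx]; exact (g⁻¹ • r).2
    change lAction hS.twoSided s (toLClass hS.twoSided heI he0 x) = _
    rw [lAction_toLClass_of_mem_RClass he hR]
    refine congrArg some (toLClass_eq_iff.2 ⟨Or.inr ⟨(g⁻¹).val, hx.symm⟩, Or.inr ⟨g.val, ?_⟩⟩)
    change r.1 = g.val * (x.1 * s)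
    rw [← hg, RClass.smul_val, mul_assoc]

theorem toLClass_surjective (hS : IsGroupMapping I) (he : IsIdempotentElem e) :
    Function.Surjective (toLClass hS.twoSided heI he0) := by
  intro b
  induction b using Quotient.ind with
  | _ w =>
    obtain ⟨w, hw, h0⟩ := w
    obtain ⟨y, x₀, x, -, hx₀, rfl⟩ := hS.exists_eq_mul he heI he0 hw h0
    refine ⟨x, Quotient.sound (s := lSetoid I) ⟨Or.inr ⟨x₀.1, ?_⟩, Or.inr ⟨y, rfl⟩⟩⟩
    rw [← mul_assoc, hx₀, x.left_id he]

theorem IsTrivialization.eq_of_toLClass_eq {f : RClass e → MaxSubgroup he}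
    (hf : IsTrivialization he f) (hS : IsGroupMapping I) {x x' : RClass e} (hxx : f x = f x')
    (h : toLClass hS.twoSided heI he0 x = toLClass hS.twoSided heI he0 x') : x = x' :=
  hf.eq_of_leL hS heI he0 (toLClass_eq_iff.1 h).2 hxx

/-- A fiber on `R` lies in one level set of `f`, where an element is determined by its `L`-class.
Hence the projection to `B` is injective on it, and its image is a whole fiber by
`mem_fiber_lAction`. -/
theorem IsTrivialization.fiberGraph_adj_iff {f : RClass e → MaxSubgroup he}
    (hf : IsTrivialization he f) (hS : IsGroupMapping I) (x x' : RClass e) :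
    (fiberGraph (actionTS e)).Adj x x' ↔ f x = f x' ∧ (fiberGraph (RLM hS.twoSided)).Adj
      (toLClass hS.twoSided heI he0 x) (toLClass hS.twoSided heI he0 x') := by
  constructor
  · rintro ⟨hne, _, ⟨s, rfl⟩, r, hr⟩
    have hx : x.1 * s = r.1 := mem_fiber_rightAction.1 (hr ▸ Or.inl rfl)
    have hx' : x'.1 * s = r.1 := mem_fiber_rightAction.1 (hr ▸ Or.inr rfl)
    have hfx : f x = f x' := hf.eq_of_mul_eq_mul (hx.trans hx'.symm) (by rw [hx]; exact r.2)
    refine ⟨hfx, fun h => hne (hf.eq_of_toLClass_eq hS hfx h), _, ⟨s, rfl⟩,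
      toLClass hS.twoSided heI he0 r, Set.Subset.antisymm ?_ ?_⟩
    · intro b hb
      obtain ⟨z, rfl⟩ := toLClass_surjective (heI := heI) (he0 := he0) hS he b
      obtain ⟨g, hg⟩ := (mem_fiber_lAction hS he).1 hb
      have hz : g • z ∈ ({x, x'} : Set (RClass e)) := hr ▸ mem_fiber_rightAction.2 hg
      rw [← toLClass_smul g z]
      rcases hz with hz | hz
      · exact Or.inl (congrArg _ hz)
      · exact Or.inr (congrArg _ hz)
    · rintro b (rfl | rfl)
      · exact (mem_fiber_lAction hS he).2 ⟨1, by rw [one_smul, hx]⟩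
      · exact (mem_fiber_lAction hS he).2 ⟨1, by rw [one_smul, hx']⟩
  · rintro ⟨hfx, hne, _, ⟨s, rfl⟩, d, hd⟩
    obtain ⟨r, rfl⟩ := toLClass_surjective (heI := heI) (he0 := he0) hS he d
    obtain ⟨g, hg⟩ := (mem_fiber_lAction (x := x) hS he).1
      (Set.ext_iff.1 hd _ |>.2 (Or.inl rfl))
    obtain ⟨g', hg'⟩ := (mem_fiber_lAction (x := x') hS he).1
      (Set.ext_iff.1 hd _ |>.2 (Or.inr rfl))
    -- `g x` and `g' x'` lie in one fiber, so `g f(x) = g' f(x')`, and `f x = f x'` cancels.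
    have hgg : g = g' := by
      have := hf.eq_of_mul_eq_mul (hg.trans hg'.symm) (by rw [hg]; exact r.2)
      rwa [hf.map_smul, hf.map_smul, hfx, mul_left_inj] at this
    subst hgg
    -- Translating by `g⁻¹` moves the fiber over `r`, which contains `g x` and `g x'`, to the fiber
    -- over `g⁻¹ r`, which contains `x` and `x'`.
    have hiff : ∀ z : RClass e, z.1 * s = (g⁻¹ • r).1 ↔ (g • z).1 * s = r.1 := by
      intro z
      rw [RClass.smul_val, RClass.smul_val]
      constructor
      · intro h
        rw [mul_assoc, h, ← mul_assoc, g.val_mul_inv, r.left_id he]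
      · intro h
        rw [← h, ← mul_assoc, ← mul_assoc, g.val_inv_mul, z.left_id he]
    refine ⟨fun h => hne (congrArg _ h), _, ⟨s, rfl⟩, g⁻¹ • r, Set.Subset.antisymm ?_ ?_⟩
    · intro z hz
      have hz' := mem_fiber_rightAction.1 hz
      have hzx : f z = f x := by
        refine hf.eq_of_mul_eq_mul (hz'.trans ((hiff x).2 hg).symm) ?_
        rw [hz']
        exact (g⁻¹ • r).2
      have hb : toLClass hS.twoSided heI he0 z ∈
          ({toLClass hS.twoSided heI he0 x, toLClass hS.twoSided heI he0 x'} : Set (LClass I)) :=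
        hd ▸ (mem_fiber_lAction hS he).2 ⟨g, (hiff z).1 hz'⟩
      rcases hb with hb | hb
      · exact Or.inl (hf.eq_of_toLClass_eq hS hzx hb)
      · exact Or.inr (hf.eq_of_toLClass_eq hS (hzx.trans hfx) hb)
    · rintro z (rfl | rfl)
      · exact mem_fiber_rightAction.2 ((hiff _).2 hg)
      · exact mem_fiber_rightAction.2 ((hiff _).2 hg')

theorem IsTrivialization.isTrivialCover {f : RClass e → MaxSubgroup he}
    (hf : IsTrivialization he f) (hS : IsGroupMapping I) (heI : e ∈ I) (he0 : ¬ IsZeroElt e) :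
    IsTrivialCover (MaxSubgroup he) (fiberGraph (actionTS e)) (fiberGraph (RLM hS.twoSided))
      (toLClass hS.twoSided heI he0) := by
  let F : RClass e → MaxSubgroup he × LClass I := fun x => (f x, toLClass hS.twoSided heI he0 x)
  have hF : Function.Bijective F := by
    constructor
    · exact fun x x' h => hf.eq_of_toLClass_eq (heI := heI) (he0 := he0) hS (congrArg Prod.fst h)
        (congrArg Prod.snd h)
    · rintro ⟨g, b⟩
      obtain ⟨x, rfl⟩ := toLClass_surjective (heI := heI) (he0 := he0) hS he b
      -- This translate stays in the `L`-class of `x` and has `f`-value `g`.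
      refine ⟨(g * (f x)⁻¹) • x, Prod.ext ?_
        (toLClass_smul (hI := hS.twoSided) (heI := heI) (he0 := he0) _ _)⟩
      change f _ = g
      rw [hf.map_smul, inv_mul_cancel_right]
  exact ⟨⟨Equiv.ofBijective F hF, fun {x x'} =>
      (hf.fiberGraph_adj_iff (heI := heI) (he0 := he0) hS x x').symm⟩,
    fun x => rfl, fun g x => Prod.ext (hf.map_smul g x)
      (toLClass_smul (hI := hS.twoSided) (heI := heI) (he0 := he0) g x)⟩

end Cover

end GMSemigroup

/-! ### The equivalence of the three conditions -/

open GMSemigroup in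
theorem theorem5p9 {S : Type*} [Semigroup S] [Finite S]
    (I : Subsemigroup S) (hS : IsGroupMapping I)
    (e : S) (he : IsIdempotentElem e) (heI : e ∈ I) (he0 : ¬ IsZeroElt e)
    (hdeg : degree (actionTS e) = 2) :
    List.TFAE
      [IsTrivialCover (MaxSubgroup he) (fiberGraph (actionTS e)) (fiberGraph (RLM hS.twoSided))
          (toLClass hS.twoSided heI he0),
        HasZeroOneReesForm I,
        OnlyTrivialSubgroups (idempotentGenerated I)] := by
  tfae_have 1 → 2 := fun h =>
    (h.exists_isTrivialization hS.twoSided heI he0 hdeg.le).elim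
      fun _ hf => hf.hasZeroOneReesForm hS heI he0
  tfae_have 2 → 3 := fun h => h.onlyTrivialSubgroups
  tfae_have 3 → 1 := fun h =>
    (h.exists_isTrivialization hS.twoSided he heI).elim
      fun _ hf => hf.isTrivialCover hS heI he0
  tfae_finish
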